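/- Let $M$ be a smooth manifold (finite-dimensional, without boundary, Hausdorff, second countable), write $\Gamma(V)$ for the smooth sections of a vector bundle $V\to M$, and let $E\to M$ be a Courant algebroid, that is, a smooth real vector bundle of finite constant rank with a smooth fibrewise nondegenerate symmetric bilinear form $\langle\cdot,\cdot\rangle$, an $\mathbb R$-bilinear bracket $[\![\cdot,\cdot]\!]$ on $\Gamma(E)$ and a smooth vector bundle map $\rho:E\to TM$ such that for all $e_1,e_2,e_3\in\Gamma(E)$ \begin{enumerate} \item $[\![e_1,[\![e_2,e_3]\!]]\!]=[\![[\![e_1,e_2]\!],e_3]\!]+[\![e_2,[\![e_1,e_3]\!]]\!]$, \item $\rho(e_1)\langle e_2,e_3\rangle=\langle[\![e_1,e_2]\!],e_3\rangle+\langle e_2,[\![e_1,e_3]\!]\rangle$, \item $[\![e_1,e_2]\!]+[\![e_2,e_1]\!]=d_E\langle e_1,e_2\rangle$, where $d_E:C^\infty(M)\to\Gamma(E)$ is defined by $\langle d_Ef,e\rangle=\rho(e)(f)$. \end{enumerate} Let $(B,d_B,\langle\!\langle\cdot,\cdot\rangle\!\rangle)$ be a predual of $E$: $B\to M$ is a smooth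 real vector bundle of finite constant rank, $\langle\!\langle\cdot,\cdot\rangle\!\rangle:E\times_M B\to\mathbb R$ is a smooth fibrewise bilinear pairing, and $d_B:C^\infty(M)\to\Gamma(B)$ is a map with $\langle\!\langle e,d_Bf\rangle\!\rangle=\rho(e)(f)$ for all $e\in\Gamma(E)$, $f\in C^\infty(M)$. Let $K_x=\{b\in B_x:\langle\!\langle e,b\rangle\!\rangle=0\text{ for all }e\in E_x\}$, and assume that $K=\bigcup_x K_x$ is a smooth subbundle of $B$ (equivalently, that the pairing has locally constant rank) and that there is a smooth splitting $B=W\oplus K$ such that $d_Bf\in\Gamma(W)$ for all $f\in C^\infty(M)$. (If $K=0$, this assumption is void.) Then the set $\mathfrak C(E,B)$ of $E$-Dorfman connections on $B$ is non-empty: there is an $\mathbb R$-bilinear map $\nabla:\Gamma(E)\times\Gamma(B)\to\Gamma(B)$ such that for all $e\in\Gamma(E)$, $b\in\Gamma(B)$, $f\in C^\infty(M)$ \begin{enumerate} \item $\nabla_{fe}b=f\nabla_eb+\langle\!\langle e,b\rangle\!\rangle\,d_Bf$, \item $\nabla_e(fb)=f\nabla_eb+\rho(e)(f)\,b$, \item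 $\nabla_e(d_Bf)=d_B(\mathcal L_{\rho(e)}f)$, where $\mathcal L_{\rho(e)}f=\rho(e)(f)$. \end{enumerate} -/

import Mathlib

open Bundle
open scoped Manifold ContDiff Bundle

noncomputable section

namespace Dorfman

section Basic

variable {n : ℕ} {M : Type*} [TopologicalSpace M] [ChartedSpace (EuclideanSpace ℝ (Fin n)) M]
  {F : Type*} [NormedAddCommGroup F] [NormedSpace ℝ F]
  {V : M → Type*} [TopologicalSpace (TotalSpace F V)]
  [∀ x, AddCommGroup (V x)] [∀ x, Module ℝ (V x)] [∀ x, TopologicalSpace (V x)]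
  [FiberBundle F V] [VectorBundle ℝ F V]

/-- The product `f s` of a smooth function and a smooth section. -/
def fsmul (f : C^∞⟮𝓡 n, M; ℝ⟯) (s : Cₛ^∞⟮𝓡 n; F, V⟯) : Cₛ^∞⟮𝓡 n; F, V⟯ :=
  ⟨fun x => f x • s x, f.contMDiff.smul_section s.contMDiff⟩

/-- The derivative `X(f)` of a smooth function along a smooth vector field, which is also the
Lie derivative of `f` along `X`. -/
def lieDeriv [IsManifold (𝓡 n) ∞ M]
    (X : Cₛ^∞⟮𝓡 n; EuclideanSpace ℝ (Fin n), (TangentSpace (𝓡 n) : M → Type _)⟯)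
    (f : C^∞⟮𝓡 n, M; ℝ⟯) : C^∞⟮𝓡 n, M; ℝ⟯ :=
  ⟨fun x => mvfderiv (𝓡 n) f x (X x), by
    have h1 := f.contMDiff.contMDiff_tangentMap (m := ∞) (by simp)
    have h2 := h1.comp X.contMDiff
    exact (contMDiff_snd_tangentBundle_modelSpace ℝ 𝓘(ℝ, ℝ)).comp h2⟩

end Basic

section Bilinear

variable {n : ℕ} {M : Type*} [TopologicalSpace M] [ChartedSpace (EuclideanSpace ℝ (Fin n)) M]
  {F₁ : Type*} [NormedAddCommGroup F₁] [NormedSpace ℝ F₁]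
  {V₁ : M → Type*} [TopologicalSpace (TotalSpace F₁ V₁)]
  [∀ x, AddCommGroup (V₁ x)] [∀ x, Module ℝ (V₁ x)] [∀ x, TopologicalSpace (V₁ x)]
  [∀ x, IsTopologicalAddGroup (V₁ x)] [∀ x, ContinuousSMul ℝ (V₁ x)]
  [FiberBundle F₁ V₁] [VectorBundle ℝ F₁ V₁]
  {F₂ : Type*} [NormedAddCommGroup F₂] [NormedSpace ℝ F₂]
  {V₂ : M → Type*} [TopologicalSpace (TotalSpace F₂ V₂)]
  [∀ x, AddCommGroup (V₂ x)] [∀ x, Module ℝ (V₂ x)] [∀ x, TopologicalSpace (V₂ x)]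
  [∀ x, IsTopologicalAddGroup (V₂ x)] [∀ x, ContinuousSMul ℝ (V₂ x)]
  [FiberBundle F₂ V₂] [VectorBundle ℝ F₂ V₂]

variable (n F₁ V₁ F₂ V₂) in
/-- Smooth vector bundle maps `V₁ → V₂` over the identity: smooth sections of `Hom(V₁, V₂)`. -/
abbrev BundleMap := Cₛ^∞⟮𝓡 n; F₁ →L[ℝ] F₂, fun x : M => V₁ x →L[ℝ] V₂ x⟯

/-- The map induced on sections by a smooth vector bundle map. -/
def BundleMap.app (φ : BundleMap n F₁ V₁ F₂ V₂) (s : Cₛ^∞⟮𝓡 n; F₁, V₁⟯) : Cₛ^∞⟮𝓡 n; F₂, V₂⟯ :=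
  ⟨fun x => φ x (s x), φ.contMDiff.clm_bundle_apply s.contMDiff⟩

variable (n F₁ V₁ F₂ V₂) in
/-- Smooth fibrewise bilinear pairings `V₁ ×_M V₂ → ℝ`. -/
abbrev Pairing :=
  Cₛ^∞⟮𝓡 n; F₁ →L[ℝ] F₂ →L[ℝ] ℝ, fun x : M => V₁ x →L[ℝ] V₂ x →L[ℝ] Bundle.Trivial M ℝ x⟯

/-- The smooth function obtained by pairing two smooth sections. -/
def Pairing.app (p : Pairing n F₁ V₁ F₂ V₂) (s : Cₛ^∞⟮𝓡 n; F₁, V₁⟯) (t : Cₛ^∞⟮𝓡 n; F₂, V₂⟯) :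
    C^∞⟮𝓡 n, M; ℝ⟯ :=
  ⟨fun x => p x (s x) (t x), by
    have h := p.contMDiff.clm_bundle_apply₂ s.contMDiff t.contMDiff
    intro x
    exact ((contMDiffAt_section x).1 (h x))⟩

end Bilinear

variable (n : ℕ) {M : Type*} [TopologicalSpace M] [ChartedSpace (EuclideanSpace ℝ (Fin n)) M]
  [IsManifold (𝓡 n) ∞ M]
  (F : Type*) [NormedAddCommGroup F] [NormedSpace ℝ F]
  (E : M → Type*) [TopologicalSpace (TotalSpace F E)]
  [∀ x, AddCommGroup (E x)] [∀ x, Module ℝ (E x)] [∀ x, TopologicalSpace (E x)]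
  [∀ x, IsTopologicalAddGroup (E x)] [∀ x, ContinuousSMul ℝ (E x)]
  [FiberBundle F E] [VectorBundle ℝ F E]

/-- A Courant algebroid structure on the smooth vector bundle `E` over `M`. -/
structure CourantAlgebroid where
  /-- the fibrewise bilinear form `⟨·,·⟩` -/
  metric : Pairing n F E F E
  metric_symm : ∀ x (u v : E x), metric x u v = metric x v u
  metric_nondegenerate : ∀ x (u : E x), (∀ v : E x, metric x u v = 0) → u = 0
  /-- the bracket `⟦·,·⟧` -/
  bracket : Cₛ^∞⟮𝓡 n; F, E⟯ →ₗ[ℝ] Cₛ^∞⟮𝓡 n; F, E⟯ →ₗ[ℝ] Cₛ^∞⟮𝓡 n; F, E⟯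
  /-- the anchor `ρ : E → TM` -/
  anchor : BundleMap n F E (EuclideanSpace ℝ (Fin n)) (TangentSpace (𝓡 n) : M → Type _)
  jacobi : ∀ e₁ e₂ e₃,
    bracket e₁ (bracket e₂ e₃) = bracket (bracket e₁ e₂) e₃ + bracket e₂ (bracket e₁ e₃)
  compat : ∀ e₁ e₂ e₃, lieDeriv (anchor.app e₁) (metric.app e₂ e₃) =
    metric.app (bracket e₁ e₂) e₃ + metric.app e₂ (bracket e₁ e₃)
  /-- the operator `d_E`; by nondegeneracy of `⟨·,·⟩` it exists and is unique -/
  dE : C^∞⟮𝓡 n, M; ℝ⟯ → Cₛ^∞⟮𝓡 n; F, E⟯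
  metric_dE : ∀ f e, metric.app (dE f) e = lieDeriv (anchor.app e) f
  bracket_add_swap : ∀ e₁ e₂, bracket e₁ e₂ + bracket e₂ e₁ = dE (metric.app e₁ e₂)

variable {n F E}

/-- The derivative `ρ(e)(f)`. -/
def CourantAlgebroid.deriv (A : CourantAlgebroid n F E) (e : Cₛ^∞⟮𝓡 n; F, E⟯)
    (f : C^∞⟮𝓡 n, M; ℝ⟯) : C^∞⟮𝓡 n, M; ℝ⟯ :=
  lieDeriv (A.anchor.app e) f

/-- A predual structure `(d_B, ⟨⟨·,·⟩⟩)` of the Courant algebroid `E` on the bundle `B`. -/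
structure Predual (A : CourantAlgebroid n F E)
    (G : Type*) [NormedAddCommGroup G] [NormedSpace ℝ G]
    (B : M → Type*) [TopologicalSpace (TotalSpace G B)]
    [∀ x, AddCommGroup (B x)] [∀ x, Module ℝ (B x)] [∀ x, TopologicalSpace (B x)]
    [∀ x, IsTopologicalAddGroup (B x)] [∀ x, ContinuousSMul ℝ (B x)]
    [FiberBundle G B] [VectorBundle ℝ G B] where
  /-- the pairing `⟨⟨·,·⟩⟩ : E ×_M B → ℝ` -/
  pairing : Pairing n F E G B
  /-- the operator `d_B` -/
  dB : C^∞⟮𝓡 n, M; ℝ⟯ → Cₛ^∞⟮𝓡 n; G, B⟯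
  pairing_dB : ∀ e f, pairing.app e (dB f) = A.deriv e f

section Predual

variable {A : CourantAlgebroid n F E}
  {G : Type*} [NormedAddCommGroup G] [NormedSpace ℝ G]
  {B : M → Type*} [TopologicalSpace (TotalSpace G B)]
  [∀ x, AddCommGroup (B x)] [∀ x, Module ℝ (B x)] [∀ x, TopologicalSpace (B x)]
  [∀ x, IsTopologicalAddGroup (B x)] [∀ x, ContinuousSMul ℝ (B x)]
  [FiberBundle G B] [VectorBundle ℝ G B]

/-- The kernel `K_x` of `E_x` in `B_x`. -/
def Predual.kernel (P : Predual A G B) (x : M) : Set (B x) :=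
  {b | ∀ e : E x, P.pairing x e b = 0}

/-- There is a smooth splitting `B = W ⊕ K`, with `K` the kernel of `E` in `B`, such that `d_B`
takes values in `W`. The splitting is given by the projection `q` of `B` onto `W` along `K`.
If `K = 0` then `q = id` is such a projection, and the condition is void. -/
def Predual.IsSplit (P : Predual A G B) : Prop :=
  ∃ q : BundleMap n G B G B,
    (∀ x b, q x (q x b) = q x b) ∧
    (∀ x b, q x b = 0 ↔ b ∈ P.kernel x) ∧
    (∀ f x, q x (P.dB f x) = P.dB f x)

/-- The set `𝔆(E, B)` of `E`-Dorfman connections on `B`. -/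
def dorfmanConnections (P : Predual A G B) :
    Set (Cₛ^∞⟮𝓡 n; F, E⟯ →ₗ[ℝ] Cₛ^∞⟮𝓡 n; G, B⟯ →ₗ[ℝ] Cₛ^∞⟮𝓡 n; G, B⟯) :=
  {D | (∀ f e b, D (fsmul f e) b = fsmul f (D e b) + fsmul (P.pairing.app e b) (P.dB f)) ∧
    (∀ f e b, D e (fsmul f b) = fsmul f (D e b) + fsmul (A.deriv e f) b) ∧
    (∀ f e, D e (P.dB f) = P.dB (A.deriv e f))}

end Predual

end Dorfman

end

open Module Topology

set_option linter.unusedSectionVars false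

namespace Dorfman

/-! ### Global sections forming a frame near a point -/

section Frame

variable {n : ℕ} {M : Type*} [TopologicalSpace M] [ChartedSpace (EuclideanSpace ℝ (Fin n)) M]
  {F : Type*} [NormedAddCommGroup F] [NormedSpace ℝ F]
  {V : M → Type*} [TopologicalSpace (TotalSpace F V)]
  [∀ x, AddCommGroup (V x)] [∀ x, Module ℝ (V x)] [∀ x, TopologicalSpace (V x)]
  [FiberBundle F V] [VectorBundle ℝ F V]

/-! For a section `b` of `B`, the Lie derivative along `e` is tested against `e'` by `ρ(e)⟨⟨e', b⟩⟩
- ⟨⟨⟦e, e'⟧, b⟩⟩`. Replacing `e` by `fe` produces the wanted term `⟨⟨e, b⟩⟩ ρ(e')(f)` and an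
unwanted `-⟨e, e'⟩ ⟨⟨d_E f, b⟩⟩`. If `e = ∑ cᵢ(e) σᵢ` in a frame, adding `∑ ⟨σᵢ, e'⟩ ⟨⟨d_E cᵢ(e),
b⟩⟩` cancels the latter. The correction is invisible on `b = d_B f`, because `⟨⟨d_E g, d_B f⟩⟩ =
ρ(d_E g)(f) = 0`; there the form equals `ρ(e')(ρ(e)(f))`, because `ρ` preserves brackets. Both facts
about `ρ` follow from the axioms (`deriv_bracket`, `derivAt_dE`).

To pass from these scalars to a section, the projection `q` onto `W` is written locally as `∑ ⟨⟨sⱼ,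
·⟩⟩ tⱼ` (`Pairing.exists_sum_smul_eq_proj`), and the corrected form for `e' = sⱼ` becomes the
coefficient of `tⱼ`. On `K` an ordinary flat connection in a frame, compressed by `1 - q`, suffices,
since the pairing vanishes on `K` and `d_B` has no component there. The identities are affine in the
connection, so local solutions are glued by a partition of unity. -/

@[simp]
lemma fsmul_apply (f : C^∞⟮𝓡 n, M; ℝ⟯) (s : Cₛ^∞⟮𝓡 n; F, V⟯) (x : M) :
    fsmul f s x = f x • s x := rfl

lemma section_add_apply (s t : Cₛ^∞⟮𝓡 n; F, V⟯) (x : M) : (s + t) x = s x + t x := rfl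

lemma section_sub_apply (s t : Cₛ^∞⟮𝓡 n; F, V⟯) (x : M) : (s - t) x = s x - t x := rfl

lemma section_smul_apply (c : ℝ) (s : Cₛ^∞⟮𝓡 n; F, V⟯) (x : M) : (c • s) x = c • s x := rfl

lemma section_sum_apply {ι : Type*} (I : Finset ι) (s : ι → Cₛ^∞⟮𝓡 n; F, V⟯) (x : M) :
    (∑ i ∈ I, s i) x = ∑ i ∈ I, s i x := by
  classical
  induction I using Finset.induction_on with
  | empty => simp
  | insert a I ha ih => simp [Finset.sum_insert ha, ih]

variable [T2Space M] [IsManifold (𝓡 n) ∞ M]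

/-- Near every point a smooth vector bundle of finite rank has a frame which consists of global
smooth sections and whose coefficient functionals are defined globally. -/
theorem exists_frame [FiniteDimensional ℝ F] [ContMDiffVectorBundle ∞ F V (𝓡 n)] (x₀ : M) :
    ∃ (s : Fin (finrank ℝ F) → Cₛ^∞⟮𝓡 n; F, V⟯)
      (c : Fin (finrank ℝ F) → ∀ x, V x →ₗ[ℝ] ℝ),
      (∀ i (v : Cₛ^∞⟮𝓡 n; F, V⟯), ContMDiff (𝓡 n) 𝓘(ℝ, ℝ) ∞ fun x => c i x (v x)) ∧
      ∀ᶠ x in 𝓝 x₀, (∀ v : V x, ∑ i, c i x v • s i x = v) ∧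
        ∀ i j, c i x (s j x) = if i = j then 1 else 0 := by
  have : ContMDiffVectorBundle 1 F V (𝓡 n) := .of_le (n := ∞) (by simp)
  let e := trivializationAt F V x₀
  let b := finBasis ℝ F
  have he : e.baseSet ∈ 𝓝 x₀ := e.open_baseSet.mem_nhds (mem_baseSet_trivializationAt F V x₀)
  -- Cutting off both the frame and its coefficients by `ψ` makes them global; duality survives
  -- where `ψ = 1`.
  obtain ⟨ψ, -, hψ⟩ := (SmoothBumpFunction.nhds_basis_tsupport (I := 𝓡 n) x₀).mem_iff.1 he
  refine ⟨fun i => ⟨fun x => ψ x • e.localFrame b i x, ?_⟩,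
    fun i x => ψ x • e.localFrameCoeff (𝓡 n) b i x, fun i v => ?_, ?_⟩
  · exact ContMDiffOn.smul_section_of_tsupport ψ.contMDiff.contMDiffOn e.open_baseSet hψ
      (e.contMDiffOn_localFrame_baseSet ∞ b i)
  · refine contMDiff_of_tsupport fun x hx => ?_
    have hx' : x ∈ e.baseSet := hψ (tsupport_smul_subset_left
      (f := ψ) (g := fun x => e.localFrameCoeff (𝓡 n) b i x (v x)) hx)
    exact ψ.contMDiffAt.smul (contMDiffAt_localFrameCoeff b hx' (v.contMDiff x) i)
  · filter_upwards [ψ.eventuallyEq_one, he] with x h1 hx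
    have h1 : ψ x = 1 := h1
    have hc : ∀ (v : V x) i, e.localFrameCoeff (𝓡 n) b i x v = (e.basisAt b hx).repr v i := by
      classical
      intro v i
      -- The coefficient at `x` depends only on the value there, so `v` may be extended by zero to a
      -- discontinuous section.
      simpa using e.localFrameCoeff_apply_of_mem_baseSet (I := 𝓡 n) b hx
        (Function.update 0 x v) i
    constructor
    · intro v
      simp [h1, hx, hc, (e.basisAt b hx).sum_repr]
    · intro i j
      simp [h1, hx, hc, Finsupp.single_apply, eq_comm]

lemma exists_section_eq [FiniteDimensional ℝ F] [ContMDiffVectorBundle ∞ F V (𝓡 n)]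
    {x₀ : M} (v : V x₀) : ∃ s : Cₛ^∞⟮𝓡 n; F, V⟯, s x₀ = v := by
  obtain ⟨s, c, -, h⟩ := exists_frame (n := n) (F := F) (V := V) x₀
  exact ⟨∑ i, c i x₀ v • s i, by
    rw [section_sum_apply]; exact h.self_of_nhds.1 v⟩

/-- A smooth function which does not vanish at a point has a smooth inverse near that point. -/
lemma exists_eventually_mul_eq_one {x₀ : M} (f : C^∞⟮𝓡 n, M; ℝ⟯) (hf : f x₀ ≠ 0) :
    ∃ g : C^∞⟮𝓡 n, M; ℝ⟯, ∀ᶠ x in 𝓝 x₀, g x * f x = 1 := by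
  have hU : {x | f x ≠ 0} ∈ 𝓝 x₀ := (f.contMDiff.continuous.continuousAt).eventually_ne hf
  obtain ⟨ψ, -, hψ⟩ := (SmoothBumpFunction.nhds_basis_tsupport (I := 𝓡 n) x₀).mem_iff.1 hU
  refine ⟨⟨fun x => ψ x • (f x)⁻¹, contMDiff_of_tsupport fun x hx => ?_⟩, ?_⟩
  · have hx' : f x ≠ 0 := hψ (tsupport_smul_subset_left (f := ψ) (g := fun x => (f x)⁻¹) hx)
    exact ψ.contMDiffAt.smul ((f.contMDiff x).inv₀ hx')
  · filter_upwards [ψ.eventuallyEq_one, hU] with x h1 hx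
    have h1 : ψ x = 1 := h1
    change ψ x • (f x)⁻¹ * f x = 1
    rw [h1, one_smul, inv_mul_cancel₀ hx]

end Frame

/-! ### Differentials of smooth functions -/

section LieDeriv

variable {n : ℕ} {M : Type*} [TopologicalSpace M]
  [ChartedSpace (EuclideanSpace ℝ (Fin n)) M]

lemma mdifferentiableAt_of_smooth (f : C^∞⟮𝓡 n, M; ℝ⟯) (x : M) :
    MDifferentiableAt (𝓡 n) 𝓘(ℝ, ℝ) f x :=
  f.contMDiff.mdifferentiableAt (by simp)

lemma mvfderiv_coe_add (f g : C^∞⟮𝓡 n, M; ℝ⟯) (x : M) :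
    mvfderiv (𝓡 n) (f + g : C^∞⟮𝓡 n, M; ℝ⟯) x = mvfderiv (𝓡 n) f x + mvfderiv (𝓡 n) g x :=
  mvfderiv_add (mdifferentiableAt_of_smooth f x) (mdifferentiableAt_of_smooth g x)

lemma mvfderiv_coe_mul (f g : C^∞⟮𝓡 n, M; ℝ⟯) (x : M) :
    mvfderiv (𝓡 n) (f * g : C^∞⟮𝓡 n, M; ℝ⟯) x =
      f x • mvfderiv (𝓡 n) g x + g x • mvfderiv (𝓡 n) f x :=
  mvfderiv_mul (mdifferentiableAt_of_smooth f x) (mdifferentiableAt_of_smooth g x)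

lemma mvfderiv_coe_smul (c : ℝ) (f : C^∞⟮𝓡 n, M; ℝ⟯) (x : M) :
    mvfderiv (𝓡 n) (c • f : C^∞⟮𝓡 n, M; ℝ⟯) x = c • mvfderiv (𝓡 n) f x := by
  have h := mvfderiv_smul (I := 𝓡 n) (a := fun _ => c) (x := x) mdifferentiableAt_const
    (mdifferentiableAt_of_smooth f x)
  rw [mvfderiv_const] at h
  refine Eq.trans h ?_
  ext v
  simp

end LieDeriv

/-! ### Bundle maps and pairings on fibres -/

noncomputable section Pointwise

variable {n : ℕ} {M : Type*} [TopologicalSpace M] [ChartedSpace (EuclideanSpace ℝ (Fin n)) M]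
  {F₁ : Type*} [NormedAddCommGroup F₁] [NormedSpace ℝ F₁]
  {V₁ : M → Type*} [TopologicalSpace (TotalSpace F₁ V₁)]
  [∀ x, AddCommGroup (V₁ x)] [∀ x, Module ℝ (V₁ x)] [∀ x, TopologicalSpace (V₁ x)]
  [∀ x, IsTopologicalAddGroup (V₁ x)] [∀ x, ContinuousSMul ℝ (V₁ x)]
  [FiberBundle F₁ V₁] [VectorBundle ℝ F₁ V₁]
  {F₂ : Type*} [NormedAddCommGroup F₂] [NormedSpace ℝ F₂]
  {V₂ : M → Type*} [TopologicalSpace (TotalSpace F₂ V₂)]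
  [∀ x, AddCommGroup (V₂ x)] [∀ x, Module ℝ (V₂ x)] [∀ x, TopologicalSpace (V₂ x)]
  [∀ x, IsTopologicalAddGroup (V₂ x)] [∀ x, ContinuousSMul ℝ (V₂ x)]
  [FiberBundle F₂ V₂] [VectorBundle ℝ F₂ V₂]

lemma BundleMap.app_apply (φ : BundleMap n F₁ V₁ F₂ V₂) (s : Cₛ^∞⟮𝓡 n; F₁, V₁⟯) (x : M) :
    φ.app s x = φ x (s x) := rfl

/-- The bilinear form on the fibres over `x` given by a pairing. -/
def Pairing.bilin (p : Pairing n F₁ V₁ F₂ V₂) (x : M) : V₁ x →ₗ[ℝ] V₂ x →ₗ[ℝ] ℝ :=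
  LinearMap.mk₂ ℝ (fun u v => p x u v)
    (fun u u' v => by rw [map_add]; rfl) (fun c u v => by rw [map_smul]; rfl)
    (fun u v v' => map_add (p x u) v v') (fun c u v => map_smul (p x u) c v)

lemma Pairing.app_apply (p : Pairing n F₁ V₁ F₂ V₂) (s : Cₛ^∞⟮𝓡 n; F₁, V₁⟯)
    (t : Cₛ^∞⟮𝓡 n; F₂, V₂⟯) (x : M) : p.app s t x = p.bilin x (s x) (t x) := rfl

lemma Pairing.app_fsmul_left (p : Pairing n F₁ V₁ F₂ V₂) (f : C^∞⟮𝓡 n, M; ℝ⟯)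
    (s : Cₛ^∞⟮𝓡 n; F₁, V₁⟯) (t : Cₛ^∞⟮𝓡 n; F₂, V₂⟯) : p.app (fsmul f s) t = f * p.app s t := by
  ext x
  simp [Pairing.app_apply]

lemma Pairing.app_fsmul_right (p : Pairing n F₁ V₁ F₂ V₂) (f : C^∞⟮𝓡 n, M; ℝ⟯)
    (s : Cₛ^∞⟮𝓡 n; F₁, V₁⟯) (t : Cₛ^∞⟮𝓡 n; F₂, V₂⟯) : p.app s (fsmul f t) = f * p.app s t := by
  ext x
  simp [Pairing.app_apply]

end Pointwise

/-! ### Consequences of the Courant algebroid axioms -/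

namespace CourantAlgebroid

noncomputable section Derivation

variable {n : ℕ} {M : Type*} [TopologicalSpace M] [ChartedSpace (EuclideanSpace ℝ (Fin n)) M]
  [IsManifold (𝓡 n) ∞ M]
  {F : Type*} [NormedAddCommGroup F] [NormedSpace ℝ F]
  {E : M → Type*} [TopologicalSpace (TotalSpace F E)]
  [∀ x, AddCommGroup (E x)] [∀ x, Module ℝ (E x)] [∀ x, TopologicalSpace (E x)]
  [∀ x, IsTopologicalAddGroup (E x)] [∀ x, ContinuousSMul ℝ (E x)]
  [FiberBundle F E] [VectorBundle ℝ F E] (A : CourantAlgebroid n F E)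

/-- The linear functional `u ↦ ρ(u)(f)` on the fibre of `E` over `x`. -/
def derivAt (f : C^∞⟮𝓡 n, M; ℝ⟯) (x : M) : E x →ₗ[ℝ] ℝ :=
  (mvfderiv (𝓡 n) f x).toLinearMap ∘ₗ (A.anchor x).toLinearMap

lemma deriv_apply (e : Cₛ^∞⟮𝓡 n; F, E⟯) (f : C^∞⟮𝓡 n, M; ℝ⟯) (x : M) :
    A.deriv e f x = A.derivAt f x (e x) := rfl

lemma derivAt_add (f g : C^∞⟮𝓡 n, M; ℝ⟯) (x : M) :
    A.derivAt (f + g) x = A.derivAt f x + A.derivAt g x := by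
  simp only [derivAt, mvfderiv_coe_add]
  rfl

lemma derivAt_smul (c : ℝ) (f : C^∞⟮𝓡 n, M; ℝ⟯) (x : M) :
    A.derivAt (c • f) x = c • A.derivAt f x := by
  simp only [derivAt, mvfderiv_coe_smul]
  rfl

lemma derivAt_mul (f g : C^∞⟮𝓡 n, M; ℝ⟯) (x : M) :
    A.derivAt (f * g) x = f x • A.derivAt g x + g x • A.derivAt f x := by
  simp only [derivAt, mvfderiv_coe_mul]
  rfl

lemma compat_apply (e₁ e₂ e₃ : Cₛ^∞⟮𝓡 n; F, E⟯) (x : M) :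
    A.derivAt (A.metric.app e₂ e₃) x (e₁ x) =
      A.metric.bilin x (A.bracket e₁ e₂ x) (e₃ x) + A.metric.bilin x (e₂ x) (A.bracket e₁ e₃ x) :=
  DFunLike.congr_fun (A.compat e₁ e₂ e₃) x

lemma metric_dE_apply (f : C^∞⟮𝓡 n, M; ℝ⟯) (e : Cₛ^∞⟮𝓡 n; F, E⟯) (x : M) :
    A.metric.bilin x (A.dE f x) (e x) = A.derivAt f x (e x) :=
  DFunLike.congr_fun (A.metric_dE f e) x

variable [T2Space M] [FiniteDimensional ℝ F] [ContMDiffVectorBundle ∞ F E (𝓡 n)]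

/-- Every vector extends to a global section, so nondegeneracy can be tested on sections, which is
the form in which the axioms describe `d_E` and the bracket. -/
lemma eq_of_metric_eq {x : M} {u v : E x}
    (h : ∀ e : Cₛ^∞⟮𝓡 n; F, E⟯, A.metric.bilin x u (e x) = A.metric.bilin x v (e x)) : u = v := by
  refine sub_eq_zero.1 (A.metric_nondegenerate x _ fun w => ?_)
  obtain ⟨e, rfl⟩ := exists_section_eq (n := n) (F := F) w
  change A.metric.bilin x (u - v) (e x) = 0
  rw [map_sub, LinearMap.sub_apply, h e, sub_self]

lemma dE_add (f g : C^∞⟮𝓡 n, M; ℝ⟯) : A.dE (f + g) = A.dE f + A.dE g := by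
  ext x
  refine A.eq_of_metric_eq fun e => ?_
  simp [section_add_apply, metric_dE_apply, derivAt_add]

lemma dE_smul (c : ℝ) (f : C^∞⟮𝓡 n, M; ℝ⟯) : A.dE (c • f) = c • A.dE f := by
  ext x
  refine A.eq_of_metric_eq fun e => ?_
  simp [section_smul_apply, metric_dE_apply, derivAt_smul]

lemma dE_mul (f g : C^∞⟮𝓡 n, M; ℝ⟯) : A.dE (f * g) = fsmul f (A.dE g) + fsmul g (A.dE f) := by
  ext x
  refine A.eq_of_metric_eq fun e => ?_
  simp [section_add_apply, metric_dE_apply, derivAt_mul]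

/-- Not an axiom: it comes from comparing metric invariance for `fe'` with `f` times that for `e'`.
-/
lemma bracket_fsmul_right (f : C^∞⟮𝓡 n, M; ℝ⟯) (e e' : Cₛ^∞⟮𝓡 n; F, E⟯) :
    A.bracket e (fsmul f e') = fsmul f (A.bracket e e') + fsmul (A.deriv e f) e' := by
  ext x
  refine A.eq_of_metric_eq fun e'' => ?_
  have h1 := A.compat_apply e (fsmul f e') e'' x
  have h2 := A.compat_apply e e' e'' x
  rw [Pairing.app_fsmul_left, derivAt_mul] at h1
  simp only [fsmul_apply, section_add_apply, map_add, map_smul, LinearMap.add_apply,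
    LinearMap.smul_apply, smul_eq_mul, Pairing.app_apply, deriv_apply] at h1 ⊢
  linear_combination -h1 + f x * h2

/-- The symmetric part of the bracket is `d_E` of the metric, so swapping the arguments reduces this
to the right Leibniz rule; the extra term is the failure of skewness. -/
lemma bracket_fsmul_left (f : C^∞⟮𝓡 n, M; ℝ⟯) (e e' : Cₛ^∞⟮𝓡 n; F, E⟯) :
    A.bracket (fsmul f e) e' =
      fsmul f (A.bracket e e') - fsmul (A.deriv e' f) e + fsmul (A.metric.app e e') (A.dE f) := by
  have h1 := A.bracket_add_swap (fsmul f e) e'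
  have h2 := A.bracket_add_swap e e'
  rw [Pairing.app_fsmul_left, dE_mul, bracket_fsmul_right, ← h2] at h1
  rw [eq_sub_of_add_eq h1]
  ext x
  simp only [section_sub_apply, section_add_apply, fsmul_apply, smul_add]
  abel

/-- Isolates rank zero, where there is no nonzero vector to cancel but the anchor vanishes. -/
lemma exists_section_ne_zero_or (x : M) :
    (∃ e : Cₛ^∞⟮𝓡 n; F, E⟯, e x ≠ 0) ∨ ∀ u : E x, u = 0 := by
  by_cases h : ∀ u : E x, u = 0
  · exact .inr h
  · push Not at h
    obtain ⟨u, hu⟩ := h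
    obtain ⟨e, rfl⟩ := exists_section_eq (n := n) (F := F) u
    exact .inl ⟨e, hu⟩

lemma deriv_bracket (e₁ e₂ : Cₛ^∞⟮𝓡 n; F, E⟯) (f : C^∞⟮𝓡 n, M; ℝ⟯) :
    A.deriv (A.bracket e₁ e₂) f = A.deriv e₁ (A.deriv e₂ f) - A.deriv e₂ (A.deriv e₁ f) := by
  ext x
  rcases exists_section_ne_zero_or (n := n) (F := F) (E := E) x with ⟨e₃, h₃⟩ | h
  -- After expansion by the right Leibniz rule, Jacobi for `e₁, e₂, e₃` removes all but a multiple
  -- of `e₃`, whose coefficient is the claim.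
  · have h := A.jacobi e₁ e₂ (fsmul f e₃)
    simp only [bracket_fsmul_right, map_add] at h
    rw [A.jacobi e₁ e₂ e₃] at h
    have hx := DFunLike.congr_fun h x
    simp only [section_add_apply, fsmul_apply] at hx
    have h0 : (A.deriv (A.bracket e₁ e₂) f x -
        (A.deriv e₁ (A.deriv e₂ f) x - A.deriv e₂ (A.deriv e₁ f) x)) • e₃ x = 0 := by
      rw [← sub_eq_zero.2 hx.symm]
      module
    exact sub_eq_zero.1 ((smul_eq_zero.1 h0).resolve_right h₃)
  · have h' : ∀ (e : Cₛ^∞⟮𝓡 n; F, E⟯) g, A.deriv e g x = 0 := fun e g => by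
      rw [deriv_apply, h (e x), map_zero]
    change _ = A.deriv e₁ (A.deriv e₂ f) x - A.deriv e₂ (A.deriv e₁ f) x
    simp only [h', sub_zero]

/-- The anchor annihilates the image of `d_E`. -/
lemma derivAt_dE (f g : C^∞⟮𝓡 n, M; ℝ⟯) (x : M) : A.derivAt g x (A.dE f x) = 0 := by
  -- For functions `⟨e₁, e₂⟩`, `d_E` gives the symmetrised bracket, which the anchor sends to a
  -- symmetrised commutator, hence to zero.
  have key : ∀ e₁ e₂, A.derivAt g x (A.dE (A.metric.app e₁ e₂) x) = 0 := fun e₁ e₂ => by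
    have h1 := DFunLike.congr_fun (A.deriv_bracket e₁ e₂ g) x
    have h2 := DFunLike.congr_fun (A.deriv_bracket e₂ e₁ g) x
    rw [← A.bracket_add_swap, section_add_apply, map_add, ← deriv_apply, ← deriv_apply, h1, h2]
    change _ - _ + (_ - _) = (0 : ℝ)
    ring
  rcases exists_section_ne_zero_or (n := n) (F := F) (E := E) x with ⟨e₁, h₁⟩ | h
  · obtain ⟨e₂, h₂⟩ : ∃ e₂ : Cₛ^∞⟮𝓡 n; F, E⟯, A.metric.bilin x (e₁ x) (e₂ x) ≠ 0 := by
      by_contra! hc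
      exact h₁ (A.eq_of_metric_eq fun e => by simp [hc e])
    -- The product rule for `f⟨e₁, e₂⟩` reaches an arbitrary `f`, as `⟨e₁, e₂⟩` is nonzero at `x`.
    have h3 := key (fsmul f e₁) e₂
    rw [Pairing.app_fsmul_left, dE_mul, section_add_apply, map_add, fsmul_apply, fsmul_apply,
      map_smul, map_smul, key, smul_zero, zero_add, Pairing.app_apply] at h3
    exact (smul_eq_zero.1 h3).resolve_left h₂
  · rw [h (A.dE f x), map_zero]

end Derivation

end CourantAlgebroid

/-! ### Local factorisation of the projection through the pairing -/

/-- A linear map which vanishes on the right kernel of a bilinear form on a product with a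
finite-dimensional space factors through the form. -/
lemma exists_sum_smul_eq_of_ker {U W W' : Type*} [AddCommGroup U] [Module ℝ U]
    [FiniteDimensional ℝ U] [AddCommGroup W] [Module ℝ W] [AddCommGroup W'] [Module ℝ W']
    (p : U →ₗ[ℝ] W →ₗ[ℝ] ℝ) (q : W →ₗ[ℝ] W') (h : ∀ w, (∀ u, p u w = 0) → q w = 0) :
    ∃ (s : Fin (finrank ℝ U) → U) (t : Fin (finrank ℝ U) → W'),
      ∀ w, ∑ j, p (s j) w • t j = q w := by
  let s := finBasis ℝ U
  let L : W →ₗ[ℝ] (Fin (finrank ℝ U) → ℝ) := LinearMap.pi fun j => p (s j)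
  have hL : LinearMap.ker L ≤ LinearMap.ker q := fun w hw => by
    refine h w fun u => ?_
    have hw' : ∀ j, p (s j) w = 0 := fun j => congr_fun (LinearMap.mem_ker.1 hw) j
    have : p.flip w = 0 := s.ext fun j => hw' j
    exact LinearMap.congr_fun this u
  -- `L` embeds `W / ker L` into a coordinate space; a left inverse extends the map induced by `q`
  -- to all coordinates.
  obtain ⟨g, hg⟩ := ((LinearMap.ker L).liftQ L le_rfl).exists_leftInverse_of_injective
    (Submodule.ker_liftQ_eq_bot _ _ _ le_rfl)
  let S := (LinearMap.ker L).liftQ q hL ∘ₗ g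
  have hS : ∀ w, S (L w) = q w := fun w => by
    have := LinearMap.congr_fun hg (Submodule.Quotient.mk w)
    simp only [LinearMap.comp_apply, Submodule.liftQ_apply, LinearMap.id_apply] at this
    simp [S, this]
  refine ⟨s, fun j => S (Pi.single j 1), fun w => ?_⟩
  rw [← hS w]
  conv_rhs => rw [pi_eq_sum_univ' (L w), map_sum]
  refine Finset.sum_congr rfl fun j _ => ?_
  rw [map_smul]
  rfl

noncomputable section Coeff

variable {n : ℕ} {M : Type*} [TopologicalSpace M] [ChartedSpace (EuclideanSpace ℝ (Fin n)) M]
  {F : Type*} [NormedAddCommGroup F] [NormedSpace ℝ F]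
  {V : M → Type*} [TopologicalSpace (TotalSpace F V)]
  [∀ x, AddCommGroup (V x)] [∀ x, Module ℝ (V x)] [∀ x, TopologicalSpace (V x)]
  [FiberBundle F V] [VectorBundle ℝ F V]

/-- The functional on smooth sections given by a smooth family of linear functionals on the
fibres. -/
def coeff (c : ∀ x, V x →ₗ[ℝ] ℝ)
    (hc : ∀ v : Cₛ^∞⟮𝓡 n; F, V⟯, ContMDiff (𝓡 n) 𝓘(ℝ, ℝ) ∞ fun x => c x (v x)) :
    Cₛ^∞⟮𝓡 n; F, V⟯ →ₗ[ℝ] C^∞⟮𝓡 n, M; ℝ⟯ where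
  toFun v := ⟨fun x => c x (v x), hc v⟩
  map_add' v w := by
    ext x
    exact map_add (c x) (v x) (w x)
  map_smul' a v := by
    ext x
    exact map_smul (c x) a (v x)

variable {c : ∀ x, V x →ₗ[ℝ] ℝ}
  {hc : ∀ v : Cₛ^∞⟮𝓡 n; F, V⟯, ContMDiff (𝓡 n) 𝓘(ℝ, ℝ) ∞ fun x => c x (v x)}

lemma coeff_apply (v : Cₛ^∞⟮𝓡 n; F, V⟯) (x : M) : coeff c hc v x = c x (v x) := rfl

lemma coeff_fsmul (f : C^∞⟮𝓡 n, M; ℝ⟯) (v : Cₛ^∞⟮𝓡 n; F, V⟯) :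
    coeff c hc (fsmul f v) = f * coeff c hc v := by
  ext x
  exact map_smul (c x) (f x) (v x)

variable [T2Space M] [IsManifold (𝓡 n) ∞ M] [FiniteDimensional ℝ F]
  [ContMDiffVectorBundle ∞ F V (𝓡 n)]

/-- A smooth family of endomorphisms of the fibres which is the identity over `x₀` has a smooth
family of left inverses near `x₀`. -/
lemma exists_eventually_leftInverse (a : ∀ x, V x →ₗ[ℝ] V x)
    (T : Cₛ^∞⟮𝓡 n; F, V⟯ → Cₛ^∞⟮𝓡 n; F, V⟯) (hT : ∀ v x, T v x = a x (v x)) {x₀ : M}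
    (h₀ : a x₀ = LinearMap.id) :
    ∃ (r : ∀ x, V x →ₗ[ℝ] V x) (R : Cₛ^∞⟮𝓡 n; F, V⟯ → Cₛ^∞⟮𝓡 n; F, V⟯),
      (∀ v x, R v x = r x (v x)) ∧ ∀ᶠ x in 𝓝 x₀, ∀ v, r x (a x v) = v := by
  obtain ⟨s, c, hc, hsc⟩ := exists_frame (n := n) (F := F) (V := V) x₀
  let m : Matrix (Fin (finrank ℝ F)) (Fin (finrank ℝ F)) C^∞⟮𝓡 n, M; ℝ⟯ :=
    fun l k => coeff (c l) (hc l) (T (s k))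
  have hm : ∀ l k x, m l k x = c l x (a x (s k x)) := fun l k x => by
    change c l x (T (s k) x) = _
    rw [hT]
  let ev : ∀ x : M, C^∞⟮𝓡 n, M; ℝ⟯ →+* ℝ := fun x => ContMDiffMap.evalRingHom x
  have hdet : m.det x₀ ≠ 0 := by
    have h1 : (ev x₀).mapMatrix m = 1 := by
      ext l k
      change m l k x₀ = _
      rw [hm, h₀, LinearMap.id_apply, hsc.self_of_nhds.2, Matrix.one_apply]
    have h2 := RingHom.map_det (ev x₀) m
    rw [h1, Matrix.det_one] at h2
    change m.det x₀ = 1 at h2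
    rw [h2]
    exact one_ne_zero
  obtain ⟨h, hh⟩ := exists_eventually_mul_eq_one m.det hdet
  -- Cramer's rule over the ring of smooth functions: `h` is the inverse of the determinant near
  -- `x₀`.
  let w : Fin (finrank ℝ F) → Fin (finrank ℝ F) → C^∞⟮𝓡 n, M; ℝ⟯ := fun k l => h * m.adjugate k l
  refine ⟨fun x => ∑ k, ∑ l, w k l x • (c l x).smulRight (s k x),
    fun v => ∑ k, ∑ l, fsmul (w k l * coeff (c l) (hc l) v) (s k), fun v x => ?_, ?_⟩
  · simp [section_sum_apply, LinearMap.sum_apply, coeff_apply, mul_smul]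
  · filter_upwards [hsc, hh] with x hx hhx v
    have hinv : ∀ k k', ∑ l, w k l x * c l x (a x (s k' x)) = if k = k' then 1 else 0 := by
      intro k k'
      have h1 := congr_arg (ev x) (congr_fun (congr_fun m.adjugate_mul k) k')
      rw [Matrix.mul_apply, map_sum] at h1
      have h2 : ∀ l, ev x (m.adjugate k l * m l k') = m.adjugate k l x * m l k' x :=
        fun l => rfl
      have h3 : ev x ((m.det • (1 : Matrix _ _ C^∞⟮𝓡 n, M; ℝ⟯)) k k') =
          m.det x * if k = k' then 1 else 0 := by
        rw [Matrix.smul_apply, Matrix.one_apply, smul_eq_mul, map_mul]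
        split_ifs
        · rw [map_one]; rfl
        · rw [map_zero, mul_zero, mul_zero]
      simp only [h2, h3, hm] at h1
      calc ∑ l, w k l x * c l x (a x (s k' x))
          = h x * ∑ l, m.adjugate k l x * c l x (a x (s k' x)) := by
            rw [Finset.mul_sum]
            exact Finset.sum_congr rfl fun l _ => mul_assoc _ _ _
        _ = _ := by rw [h1, ← mul_assoc, hhx, one_mul]
    have hbasis : ∀ k', ∑ k, ∑ l, w k l x • (c l x (a x (s k' x)) • s k x) = s k' x := by
      intro k'
      simp only [← mul_smul, ← Finset.sum_smul, hinv, ite_smul, one_smul, zero_smul,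
        Finset.sum_ite_eq', Finset.mem_univ, if_true]
    have hlin : (∑ k, ∑ l, w k l x • (c l x).smulRight (s k x)) ∘ₗ a x = LinearMap.id := by
      have hk : ∀ k', (∑ k, ∑ l, w k l x • (c l x).smulRight (s k x)) (a x (s k' x)) = s k' x := by
        intro k'
        simpa [LinearMap.sum_apply] using hbasis k'
      ext u
      rw [← hx.1 u]
      simp only [map_sum, map_smul, LinearMap.comp_apply, hk, LinearMap.id_apply]
    exact LinearMap.congr_fun hlin v

end Coeff

section DualSections

variable {n : ℕ} {M : Type*} [TopologicalSpace M] [ChartedSpace (EuclideanSpace ℝ (Fin n)) M]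
  [IsManifold (𝓡 n) ∞ M] [T2Space M]
  {F : Type*} [NormedAddCommGroup F] [NormedSpace ℝ F] [FiniteDimensional ℝ F]
  {E : M → Type*} [TopologicalSpace (TotalSpace F E)]
  [∀ x, AddCommGroup (E x)] [∀ x, Module ℝ (E x)] [∀ x, TopologicalSpace (E x)]
  [∀ x, IsTopologicalAddGroup (E x)] [∀ x, ContinuousSMul ℝ (E x)]
  [FiberBundle F E] [VectorBundle ℝ F E] [ContMDiffVectorBundle ∞ F E (𝓡 n)]
  {G : Type*} [NormedAddCommGroup G] [NormedSpace ℝ G] [FiniteDimensional ℝ G]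
  {B : M → Type*} [TopologicalSpace (TotalSpace G B)]
  [∀ x, AddCommGroup (B x)] [∀ x, Module ℝ (B x)] [∀ x, TopologicalSpace (B x)]
  [∀ x, IsTopologicalAddGroup (B x)] [∀ x, ContinuousSMul ℝ (B x)]
  [FiberBundle G B] [VectorBundle ℝ G B] [ContMDiffVectorBundle ∞ G B (𝓡 n)]

/-- If `q` is a smooth projection of `B` along the right kernel of a pairing of `E` and `B`, then
`q` is locally of the form `b ↦ ∑ⱼ p(sⱼ, b) tⱼ`. -/
theorem Pairing.exists_sum_smul_eq_proj (p : Pairing n F E G B) (q : BundleMap n G B G B)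
    (hq : ∀ x b, q x (q x b) = q x b) (hker : ∀ x b, q x b = 0 ↔ ∀ e, p.bilin x e b = 0)
    (x₀ : M) :
    ∃ (d : ℕ) (s : Fin d → Cₛ^∞⟮𝓡 n; F, E⟯) (t : Fin d → Cₛ^∞⟮𝓡 n; G, B⟯),
      ∀ᶠ x in 𝓝 x₀, ∀ b : B x, ∑ j, p.bilin x (s j x) b • t j x = q x b := by
  have : FiniteDimensional ℝ (E x₀) :=
    ((trivializationAt F E x₀).linearEquivAt ℝ x₀
      (mem_baseSet_trivializationAt F E x₀)).symm.finiteDimensional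
  obtain ⟨s₀, t₀, h₀⟩ := exists_sum_smul_eq_of_ker (p.bilin x₀) (q x₀).toLinearMap
    fun b hb => (hker x₀ b).2 hb
  choose s hs using fun j => exists_section_eq (n := n) (F := F) (s₀ j)
  choose t ht using fun j => exists_section_eq (n := n) (F := G) (t₀ j)
  -- The formula for `q` holds only at `x₀` so far. Adding `1 - q` to the sum composed with `q`
  -- gives a family equal to the identity at `x₀`, hence left invertible nearby.
  obtain ⟨r, R, hR, hra⟩ := exists_eventually_leftInverse (n := n) (F := G) (V := B) (x₀ := x₀)
    (fun x => ∑ j, (p.bilin x (s j x) ∘ₗ (q x).toLinearMap).smulRight (t j x) +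
      LinearMap.id - (q x).toLinearMap)
    (fun b => ∑ j, fsmul (p.app (s j) (q.app b)) (t j) + b - q.app b)
    (fun b x => by
      simp [section_sub_apply, section_add_apply, section_sum_apply, LinearMap.sum_apply,
        Pairing.app_apply, BundleMap.app_apply])
    (by
      ext b
      have := h₀ (q x₀ b)
      simp only [ContinuousLinearMap.coe_coe, hq] at this
      simp [LinearMap.sum_apply, hs, ht, this])
  refine ⟨_, s, fun j => R (t j), ?_⟩
  filter_upwards [hra] with x hx b
  -- On `q b` the summand `1 - q` disappears, so replacing `tⱼ` by `R tⱼ` makes the formula exact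
  -- near `x₀`.
  have h1 := hx (q x b)
  have h2 : ∀ j, p.bilin x (s j x) (q x b) = p.bilin x (s j x) b := fun j => by
    have h3 : q x (b - q x b) = 0 := by rw [map_sub, hq, sub_self]
    have h4 := (hker x _).1 h3 (s j x)
    rw [map_sub, sub_eq_zero] at h4
    exact h4.symm
  simp only [LinearMap.sub_apply, LinearMap.add_apply, LinearMap.sum_apply, LinearMap.id_apply,
    LinearMap.smulRight_apply, LinearMap.comp_apply, ContinuousLinearMap.coe_coe, hq, h2,
    add_sub_cancel_right, map_sum, map_smul] at h1
  simpa only [hR] using h1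

end DualSections

/-! ### The corrected Lie derivative form -/

noncomputable section Local

variable {n : ℕ} {M : Type*} [TopologicalSpace M] [ChartedSpace (EuclideanSpace ℝ (Fin n)) M]
  [IsManifold (𝓡 n) ∞ M] [T2Space M]
  {F : Type*} [NormedAddCommGroup F] [NormedSpace ℝ F] [FiniteDimensional ℝ F]
  {E : M → Type*} [TopologicalSpace (TotalSpace F E)]
  [∀ x, AddCommGroup (E x)] [∀ x, Module ℝ (E x)] [∀ x, TopologicalSpace (E x)]
  [∀ x, IsTopologicalAddGroup (E x)] [∀ x, ContinuousSMul ℝ (E x)]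
  [FiberBundle F E] [VectorBundle ℝ F E] [ContMDiffVectorBundle ∞ F E (𝓡 n)]
  {A : CourantAlgebroid n F E}
  {G : Type*} [NormedAddCommGroup G] [NormedSpace ℝ G] [FiniteDimensional ℝ G]
  {B : M → Type*} [TopologicalSpace (TotalSpace G B)]
  [∀ x, AddCommGroup (B x)] [∀ x, Module ℝ (B x)] [∀ x, TopologicalSpace (B x)]
  [∀ x, IsTopologicalAddGroup (B x)] [∀ x, ContinuousSMul ℝ (B x)]
  [FiberBundle G B] [VectorBundle ℝ G B] [ContMDiffVectorBundle ∞ G B (𝓡 n)]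
  (P : Predual A G B)

lemma Predual.bilin_dB (e : Cₛ^∞⟮𝓡 n; F, E⟯) (f : C^∞⟮𝓡 n, M; ℝ⟯) (x : M) :
    P.pairing.bilin x (e x) (P.dB f x) = A.derivAt f x (e x) :=
  DFunLike.congr_fun (P.pairing_dB e f) x

lemma coe_add_apply (f g : C^∞⟮𝓡 n, M; ℝ⟯) (x : M) : (f + g) x = f x + g x := rfl

lemma Pairing.app_add_right (p : Pairing n F E G B) (e : Cₛ^∞⟮𝓡 n; F, E⟯)
    (b b' : Cₛ^∞⟮𝓡 n; G, B⟯) : p.app e (b + b') = p.app e b + p.app e b' := by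
  ext x
  exact map_add (p.bilin x (e x)) (b x) (b' x)

lemma Pairing.app_smul_right (p : Pairing n F E G B) (e : Cₛ^∞⟮𝓡 n; F, E⟯) (a : ℝ)
    (b : Cₛ^∞⟮𝓡 n; G, B⟯) : p.app e (a • b) = a • p.app e b := by
  ext x
  exact map_smul (p.bilin x (e x)) a (b x)

/-- The Lie derivative along `e` of a section `b` of `B`, paired with `e'`. It is corrected by a
term, built from a frame `s` of `E` with coefficients `c`, which makes it a first order
differential operator in `e` with symbol `d_B`. -/
def Predual.lieForm {ι : Type*} [Fintype ι] (s : ι → Cₛ^∞⟮𝓡 n; F, E⟯)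
    (c : ι → Cₛ^∞⟮𝓡 n; F, E⟯ →ₗ[ℝ] C^∞⟮𝓡 n, M; ℝ⟯) (e' : Cₛ^∞⟮𝓡 n; F, E⟯) :
    Cₛ^∞⟮𝓡 n; F, E⟯ →ₗ[ℝ] Cₛ^∞⟮𝓡 n; G, B⟯ →ₗ[ℝ] C^∞⟮𝓡 n, M; ℝ⟯ :=
  LinearMap.mk₂ ℝ (fun e b => A.deriv e (P.pairing.app e' b) - P.pairing.app (A.bracket e e') b +
      P.pairing.app (∑ i, fsmul (A.metric.app (s i) e') (A.dE (c i e))) b)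
    (fun e₁ e₂ b => by
      ext x
      change _ - _ + _ = (_ - _ + _ : ℝ) + (_ - _ + _ : ℝ)
      simp only [Pairing.app_apply, A.deriv_apply, map_add, LinearMap.add_apply,
        section_add_apply, section_sum_apply, fsmul_apply, A.dE_add, smul_add,
        Finset.sum_add_distrib]
      ring)
    (fun a e b => by
      ext x
      change _ - _ + _ = a * (_ - _ + _ : ℝ)
      simp only [Pairing.app_apply, A.deriv_apply, map_smul, LinearMap.smul_apply,
        section_smul_apply, section_sum_apply, fsmul_apply, A.dE_smul, smul_comm _ a,
        ← Finset.smul_sum, smul_eq_mul]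
      ring)
    (fun e b₁ b₂ => by
      ext x
      change _ - _ + _ = (_ - _ + _ : ℝ) + (_ - _ + _ : ℝ)
      simp only [Pairing.app_add_right, A.deriv_apply, A.derivAt_add, LinearMap.add_apply,
        coe_add_apply]
      ring)
    (fun a e b => by
      ext x
      change _ - _ + _ = a * (_ - _ + _ : ℝ)
      simp only [Pairing.app_smul_right, A.deriv_apply, A.derivAt_smul, LinearMap.smul_apply,
        ContMDiffMap.coe_smul, Pi.smul_apply, smul_eq_mul]
      ring)

section

variable {ι : Type*} [Fintype ι] (s : ι → Cₛ^∞⟮𝓡 n; F, E⟯)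
    (c : ι → Cₛ^∞⟮𝓡 n; F, E⟯ →ₗ[ℝ] C^∞⟮𝓡 n, M; ℝ⟯) (e e' : Cₛ^∞⟮𝓡 n; F, E⟯)
    (b : Cₛ^∞⟮𝓡 n; G, B⟯) (f : C^∞⟮𝓡 n, M; ℝ⟯)

lemma Predual.lieForm_apply (x : M) : P.lieForm s c e' e b x =
    A.derivAt (P.pairing.app e' b) x (e x) - P.pairing.bilin x (A.bracket e e' x) (b x) +
      ∑ i, A.metric.bilin x (s i x) (e' x) * P.pairing.bilin x (A.dE (c i e) x) (b x) := by
  change A.deriv e (P.pairing.app e' b) x - P.pairing.app (A.bracket e e') b x +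
    P.pairing.app (∑ i, fsmul (A.metric.app (s i) e') (A.dE (c i e))) b x = _
  simp only [A.deriv_apply, Pairing.app_apply, section_sum_apply, fsmul_apply, map_sum, map_smul,
    LinearMap.sum_apply, LinearMap.smul_apply, smul_eq_mul]

/-- The `d_E f` term of the left Leibniz rule cancels against the correction, since the frame
expansion of `e` at `x` gives `∑ ⟨σᵢ, e'⟩ cᵢ(e) = ⟨e, e'⟩` there. -/
lemma Predual.lieForm_fsmul_left (hc : ∀ i g v, c i (fsmul g v) = g * c i v) {x : M}
    (hx : ∑ i, c i e x • s i x = e x) :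
    P.lieForm s c e' (fsmul f e) b x = f x * P.lieForm s c e' e b x +
      P.pairing.bilin x (e x) (b x) * A.derivAt f x (e' x) := by
  have h : ∑ i, A.metric.bilin x (s i x) (e' x) * (c i e x * P.pairing.bilin x (A.dE f x) (b x)) =
      A.metric.bilin x (e x) (e' x) * P.pairing.bilin x (A.dE f x) (b x) := by
    rw [← hx]
    simp only [map_sum, map_smul, LinearMap.sum_apply, LinearMap.smul_apply, smul_eq_mul,
      Finset.sum_mul]
    exact Finset.sum_congr rfl fun i _ => by ring
  simp only [Predual.lieForm_apply, hc, A.dE_mul, A.bracket_fsmul_left, fsmul_apply,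
    section_add_apply, section_sub_apply, map_add, map_sub, map_smul, LinearMap.add_apply,
    LinearMap.sub_apply, LinearMap.smul_apply, smul_eq_mul, mul_add, mul_sub, Finset.mul_sum,
    Finset.sum_add_distrib, mul_left_comm _ (f x), Pairing.app_apply, A.deriv_apply, h]
  ring

lemma Predual.lieForm_fsmul_right (x : M) :
    P.lieForm s c e' e (fsmul f b) x = f x * P.lieForm s c e' e b x +
      A.derivAt f x (e x) * P.pairing.bilin x (e' x) (b x) := by
  simp only [Predual.lieForm_apply, Pairing.app_fsmul_right, A.derivAt_mul, fsmul_apply, map_smul,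
    LinearMap.add_apply, LinearMap.smul_apply, smul_eq_mul, mul_add, mul_sub, Finset.mul_sum,
    mul_left_comm _ (f x), Pairing.app_apply]
  ring

/-- The correction dies because the anchor kills `d_E`; the rest is the commutator formula for the
anchor. -/
lemma Predual.lieForm_dB (x : M) :
    P.lieForm s c e' e (P.dB f) x = A.derivAt (A.deriv e f) x (e' x) := by
  have h := DFunLike.congr_fun (A.deriv_bracket e e' f) x
  change A.derivAt f x (A.bracket e e' x) =
    A.derivAt (A.deriv e' f) x (e x) - A.derivAt (A.deriv e f) x (e' x) at h
  rw [Predual.lieForm_apply, P.pairing_dB, P.bilin_dB, h, Finset.sum_eq_zero]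
  · ring
  · intro i _
    rw [P.bilin_dB, A.derivAt_dE, mul_zero]

end

/-! ### Local Dorfman connections and gluing -/

/-- The Dorfman connection identities for `D`, over the point `x`. -/
def Predual.IsDorfmanAt
    (D : Cₛ^∞⟮𝓡 n; F, E⟯ →ₗ[ℝ] Cₛ^∞⟮𝓡 n; G, B⟯ →ₗ[ℝ] Cₛ^∞⟮𝓡 n; G, B⟯) (x : M) : Prop :=
  (∀ f e b, D (fsmul f e) b x = f x • D e b x + P.pairing.app e b x • P.dB f x) ∧
    (∀ f e b, D e (fsmul f b) x = f x • D e b x + A.deriv e f x • b x) ∧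
    (∀ f e, D e (P.dB f) x = P.dB (A.deriv e f) x)

/-- Multiplication of a fixed section by smooth functions. -/
def smulSection (t : Cₛ^∞⟮𝓡 n; G, B⟯) : C^∞⟮𝓡 n, M; ℝ⟯ →ₗ[ℝ] Cₛ^∞⟮𝓡 n; G, B⟯ where
  toFun f := fsmul f t
  map_add' f g := by
    ext x
    exact add_smul (f x) (g x) (t x)
  map_smul' a f := by
    ext x
    exact mul_smul a (f x) (t x)

/-- The complementary projection `1 - q` on sections. -/
def compl (q : BundleMap n G B G B) : Cₛ^∞⟮𝓡 n; G, B⟯ →ₗ[ℝ] Cₛ^∞⟮𝓡 n; G, B⟯ where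
  toFun b := b - q.app b
  map_add' b b' := by
    ext x
    simp only [section_sub_apply, section_add_apply, BundleMap.app_apply, map_add]
    abel
  map_smul' a b := by
    ext x
    simp only [section_sub_apply, section_smul_apply, BundleMap.app_apply, map_smul, smul_sub,
      RingHom.id_apply]

lemma compl_apply (q : BundleMap n G B G B) (b : Cₛ^∞⟮𝓡 n; G, B⟯) (x : M) :
    compl q b x = b x - q x (b x) := rfl

lemma compl_fsmul (q : BundleMap n G B G B) (f : C^∞⟮𝓡 n, M; ℝ⟯) (b : Cₛ^∞⟮𝓡 n; G, B⟯) :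
    compl q (fsmul f b) = fsmul f (compl q b) := by
  ext x
  simp only [compl_apply, fsmul_apply, map_smul, smul_sub]

variable (A) in
/-- The derivative `ρ(e)(f)` as a bilinear map. -/
def derivBilin : Cₛ^∞⟮𝓡 n; F, E⟯ →ₗ[ℝ] C^∞⟮𝓡 n, M; ℝ⟯ →ₗ[ℝ] C^∞⟮𝓡 n, M; ℝ⟯ :=
  LinearMap.mk₂ ℝ A.deriv
    (fun e₁ e₂ f => by
      ext x
      exact map_add (A.derivAt f x) (e₁ x) (e₂ x))
    (fun a e f => by
      ext x
      exact map_smul (A.derivAt f x) a (e x))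
    (fun e f g => by
      ext x
      exact LinearMap.congr_fun (A.derivAt_add f g x) (e x))
    (fun a e f => by
      ext x
      exact LinearMap.congr_fun (A.derivAt_smul a f x) (e x))

theorem Predual.exists_eventually_isDorfmanAt (hP : P.IsSplit) (x₀ : M) :
    ∃ D : Cₛ^∞⟮𝓡 n; F, E⟯ →ₗ[ℝ] Cₛ^∞⟮𝓡 n; G, B⟯ →ₗ[ℝ] Cₛ^∞⟮𝓡 n; G, B⟯,
      ∀ᶠ x in 𝓝 x₀, P.IsDorfmanAt D x := by
  obtain ⟨q, hq, hker, hdB⟩ := hP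
  obtain ⟨d, s, t, hst⟩ := P.pairing.exists_sum_smul_eq_proj q hq hker x₀
  obtain ⟨σ, c, hc, hσ⟩ := exists_frame (n := n) (F := F) (V := E) x₀
  obtain ⟨β, γ, hγ, hβ⟩ := exists_frame (n := n) (F := G) (V := B) x₀
  let φ := fun j => P.lieForm σ (fun i => coeff (c i) (hc i)) (s j)
  -- The first sum carries the Dorfman terms; the second differentiates the `K`-component of `b` in
  -- the frame `β` and projects back to `K`.
  let D : Cₛ^∞⟮𝓡 n; F, E⟯ →ₗ[ℝ] Cₛ^∞⟮𝓡 n; G, B⟯ →ₗ[ℝ] Cₛ^∞⟮𝓡 n; G, B⟯ :=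
    ∑ j, (φ j).compr₂ (smulSection (t j)) +
      ∑ k, ((derivBilin A).compl₂ (coeff (γ k) (hγ k) ∘ₗ compl q)).compr₂
        (compl q ∘ₗ smulSection (β k))
  have hD : ∀ e b x, D e b x = ∑ j, φ j e b x • t j x +
      ∑ k, A.derivAt (coeff (γ k) (hγ k) (compl q b)) x (e x) • (β k x - q x (β k x)) := by
    intro e b x
    simp only [D, LinearMap.add_apply, LinearMap.sum_apply, LinearMap.compr₂_apply,
      LinearMap.compl₂_apply, LinearMap.comp_apply, section_add_apply, section_sum_apply]
    congr 1
    refine Finset.sum_congr rfl fun k _ => ?_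
    rw [smul_sub, ← map_smul]
    rfl
  refine ⟨D, ?_⟩
  filter_upwards [hst, hσ, hβ] with x hst hσ hβ
  -- This is the local formula for `q` applied to `d_B f`, which `q` fixes because `d_B f` lies in
  -- `W`.
  have hsd : ∀ f, ∑ j, A.derivAt f x (s j x) • t j x = P.dB f x := fun f => by
    simp only [← P.bilin_dB, hst, hdB]
  refine ⟨fun f e b => ?_, fun f e b => ?_, fun f e => ?_⟩
  · have h : ∀ j, φ j (fsmul f e) b x = f x * φ j e b x +
        P.pairing.bilin x (e x) (b x) * A.derivAt f x (s j x) := fun j =>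
      P.lieForm_fsmul_left _ _ e (s j) b f (fun i g v => coeff_fsmul g v) (hσ.1 (e x))
    simp only [hD, h, fsmul_apply, map_smul, add_smul, mul_smul, smul_eq_mul,
      Finset.sum_add_distrib, ← Finset.smul_sum, hsd, Pairing.app_apply, smul_add]
    abel
  · have h : ∀ j, φ j e (fsmul f b) x = f x * φ j e b x +
        A.derivAt f x (e x) * P.pairing.bilin x (s j x) (b x) := fun j =>
      P.lieForm_fsmul_right _ _ e (s j) b f x
    have h2 : ∑ k, γ k x (b x - q x (b x)) • (β k x - q x (β k x)) = b x - q x (b x) := by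
      simp only [smul_sub, ← map_smul, Finset.sum_sub_distrib, ← map_sum, hβ.1]
      rw [map_sub, hq, sub_self, sub_zero]
    have h3 : ∀ k, A.derivAt (coeff (γ k) (hγ k) (compl q (fsmul f b))) x (e x) =
        f x * A.derivAt (coeff (γ k) (hγ k) (compl q b)) x (e x) +
          A.derivAt f x (e x) * γ k x (b x - q x (b x)) := fun k => by
      rw [compl_fsmul, coeff_fsmul, A.derivAt_mul, mul_comm (A.derivAt f x (e x))]
      rfl
    simp only [hD, h, h3, add_smul, mul_smul, Finset.sum_add_distrib, ← Finset.smul_sum, hst, h2,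
      A.deriv_apply]
    module
  · have h : compl q (P.dB f) = 0 := by
      ext x
      rw [compl_apply, hdB, sub_self]
      rfl
    have h2 : ∀ k, A.derivAt (coeff (γ k) (hγ k) (compl q (P.dB f))) x (e x) = 0 := fun k => by
      rw [h, map_zero, ← zero_smul ℝ 0, A.derivAt_smul, zero_smul, LinearMap.zero_apply]
    have h3 : ∀ j, φ j e (P.dB f) x = A.derivAt (A.deriv e f) x (s j x) := fun j =>
      P.lieForm_dB _ _ e (s j) f x
    simp only [hD, h2, h3, hsd, zero_smul, Finset.sum_const_zero, add_zero]

/-- At each point the identities are affine in `D`, with inhomogeneous terms independent of `D`, so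
they pass to combinations with weights of sum one. The local solutions already act on global
sections, so only their values are weighted. -/
theorem Predual.nonempty_of_eventually_isDorfmanAt [SigmaCompactSpace M]
    (h : ∀ x₀, ∃ D : Cₛ^∞⟮𝓡 n; F, E⟯ →ₗ[ℝ] Cₛ^∞⟮𝓡 n; G, B⟯ →ₗ[ℝ] Cₛ^∞⟮𝓡 n; G, B⟯,
      ∀ᶠ x in 𝓝 x₀, P.IsDorfmanAt D x) : (dorfmanConnections P).Nonempty := by
  choose D hD using h
  choose U hU hUo hxU using fun x₀ => eventually_nhds_iff.1 (hD x₀)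
  -- Here `ρ` is the partition of unity, not the anchor.
  obtain ⟨ρ, hρ⟩ := SmoothPartitionOfUnity.exists_isSubordinate (𝓡 n) isClosed_univ U hUo
    fun x _ => Set.mem_iUnion.2 ⟨x, hxU x⟩
  have hfin : ∀ (v : M → Cₛ^∞⟮𝓡 n; G, B⟯) x,
      ∑ᶠ i, ρ i x • v i x = ∑ i ∈ ρ.finsupport x, ρ i x • v i x := fun v x => by
    refine finsum_eq_sum_of_support_subset _ fun i hi => ?_
    rw [ρ.coe_finsupport]
    exact fun h0 => hi ((congr_arg (fun r : ℝ => r • v i x) h0).trans (zero_smul ℝ _))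
  have hsmooth : ∀ v : M → Cₛ^∞⟮𝓡 n; G, B⟯, ContMDiff (𝓡 n) ((𝓡 n).prod 𝓘(ℝ, G)) ∞
      fun x => TotalSpace.mk' G x (∑ᶠ i, ρ i x • v i x) := fun v => by
    refine ContMDiff.finsum_section_of_locallyFinite (t := fun i x => ρ i x • v i x)
      (ρ.locallyFinite.subset fun i x hx h0 => hx ?_)
      fun i => (ρ i).contMDiff.smul_section (v i).contMDiff
    rw [h0, zero_smul]
  let glue : (M → Cₛ^∞⟮𝓡 n; G, B⟯) →ₗ[ℝ] Cₛ^∞⟮𝓡 n; G, B⟯ :=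
    { toFun := fun v => ⟨fun x => ∑ᶠ i, ρ i x • v i x, hsmooth v⟩
      map_add' := fun v w => by
        ext x
        change ∑ᶠ i, ρ i x • (v + w) i x = ∑ᶠ i, ρ i x • v i x + ∑ᶠ i, ρ i x • w i x
        rw [hfin, hfin, hfin]
        simp only [Pi.add_apply, section_add_apply, smul_add, Finset.sum_add_distrib]
      map_smul' := fun a v => by
        ext x
        change ∑ᶠ i, ρ i x • (a • v) i x = a • ∑ᶠ i, ρ i x • v i x
        rw [hfin, hfin]
        simp only [Pi.smul_apply, section_smul_apply, smul_comm _ a, Finset.smul_sum] }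
  have hglue : ∀ v x, glue v x = ∑ i ∈ ρ.finsupport x, ρ i x • v i x := hfin
  let D' : Cₛ^∞⟮𝓡 n; F, E⟯ →ₗ[ℝ] Cₛ^∞⟮𝓡 n; G, B⟯ →ₗ[ℝ] Cₛ^∞⟮𝓡 n; G, B⟯ :=
    LinearMap.mk₂ ℝ (fun e b => glue fun i => D i e b)
      (fun e e' b => by simp only [map_add, LinearMap.add_apply, ← Pi.add_def])
      (fun a e b => by simp only [map_smul, LinearMap.smul_apply, ← Pi.smul_def])
      (fun e b b' => by simp only [map_add, ← Pi.add_def])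
      (fun a e b => by simp only [map_smul, ← Pi.smul_def])
  have hD' : ∀ e b x, D' e b x = ∑ i ∈ ρ.finsupport x, ρ i x • D i e b x := fun e b x =>
    hglue _ x
  have hone : ∀ x, ∑ i ∈ ρ.finsupport x, ρ i x = 1 := fun x => ρ.sum_finsupport x (Set.mem_univ x)
  have hloc : ∀ x, ∀ i ∈ ρ.finsupport x, P.IsDorfmanAt (D i) x := fun x i hi =>
    hU i x (hρ i (subset_tsupport _ ((ρ.mem_finsupport x).1 hi)))
  refine ⟨D', fun f e b => ?_, fun f e b => ?_, fun f e => ?_⟩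
  · ext x
    simp only [section_add_apply, fsmul_apply, hD']
    rw [Finset.sum_congr rfl fun i hi => by rw [(hloc x i hi).1 f e b]]
    simp only [smul_add, Finset.sum_add_distrib, ← Finset.sum_smul, hone, one_smul,
      Finset.smul_sum, smul_comm (f x)]
  · ext x
    simp only [section_add_apply, fsmul_apply, hD']
    rw [Finset.sum_congr rfl fun i hi => by rw [(hloc x i hi).2.1 f e b]]
    simp only [smul_add, Finset.sum_add_distrib, ← Finset.sum_smul, hone, one_smul,
      Finset.smul_sum, smul_comm (f x)]
  · ext x
    rw [hD', Finset.sum_congr rfl fun i hi => by rw [(hloc x i hi).2.2 f e], ← Finset.sum_smul,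
      hone, one_smul]

end Local

end Dorfman

theorem mainTheorem1 {n : ℕ} {M : Type*} [TopologicalSpace M] [T2Space M] [SigmaCompactSpace M]
    [ChartedSpace (EuclideanSpace ℝ (Fin n)) M] [IsManifold (𝓡 n) ∞ M]
    {F : Type*} [NormedAddCommGroup F] [NormedSpace ℝ F] [FiniteDimensional ℝ F]
    {E : M → Type*} [TopologicalSpace (TotalSpace F E)]
    [∀ x, AddCommGroup (E x)] [∀ x, Module ℝ (E x)] [∀ x, TopologicalSpace (E x)]
    [∀ x, IsTopologicalAddGroup (E x)] [∀ x, ContinuousSMul ℝ (E x)]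
    [FiberBundle F E] [VectorBundle ℝ F E] [ContMDiffVectorBundle ∞ F E (𝓡 n)]
    {G : Type*} [NormedAddCommGroup G] [NormedSpace ℝ G] [FiniteDimensional ℝ G]
    {B : M → Type*} [TopologicalSpace (TotalSpace G B)]
    [∀ x, AddCommGroup (B x)] [∀ x, Module ℝ (B x)] [∀ x, TopologicalSpace (B x)]
    [∀ x, IsTopologicalAddGroup (B x)] [∀ x, ContinuousSMul ℝ (B x)]
    [FiberBundle G B] [VectorBundle ℝ G B] [ContMDiffVectorBundle ∞ G B (𝓡 n)]
    (A : Dorfman.CourantAlgebroid n F E) (P : Dorfman.Predual A G B) (hP : P.IsSplit) :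
    (Dorfman.dorfmanConnections P).Nonempty := by
  exact P.nonempty_of_eventually_isDorfmanAt (P.exists_eventually_isDorfmanAt hP)
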